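/- Let $H$ be a complex Hilbert space. For a bounded linear operator $T\colon H_1\to H_2$ between complex inner product spaces let $m(T)=\inf\{\|Tx\| : x\in H_1,\ \|x\|=1\}$; call $T$ minimum attaining if there is $x_0\in H_1$ with $\|x_0\|=1$ and $\|Tx_0\|=m(T)$. A bounded linear operator $T\colon H\to H$ is called absolutely minimum attaining if, for every nonzero closed linear subspace $M$ of $H$, the restriction $T|_M\colon M\to H$ is minimum attaining. Let $V\colon H\to H$ be a partial isometry, that is, a bounded linear operator with $\|Vx\|=\|x\|$ for every $x$ in the orthogonal complement of its null space $N(V)$. Then $V$ is absolutely minimum attaining if and only if its null space $N(V)$ or its range $R(V)$ is finite dimensional. -/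

import Mathlib

section MinimumAttaining

variable {H₁ H₂ : Type*}
  [NormedAddCommGroup H₁] [InnerProductSpace ℂ H₁]
  [NormedAddCommGroup H₂] [InnerProductSpace ℂ H₂]

/-- The minimum modulus `m(T) = inf {‖T x‖ : ‖x‖ = 1}` of a bounded operator. -/
noncomputable def minimumModulus (T : H₁ →L[ℂ] H₂) : ℝ :=
  sInf {r : ℝ | ∃ x : H₁, ‖x‖ = 1 ∧ r = ‖T x‖}

/-- `T` is minimum attaining if `m(T) = ‖T x₀‖` for some unit vector `x₀`. -/
def IsMinimumAttaining (T : H₁ →L[ℂ] H₂) : Prop :=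
  ∃ x₀ : H₁, ‖x₀‖ = 1 ∧ minimumModulus T = ‖T x₀‖

/-- `T` is absolutely minimum attaining if its restriction to every nonzero closed subspace of
its domain is minimum attaining. -/
def IsAbsolutelyMinimumAttaining (T : H₁ →L[ℂ] H₂) : Prop :=
  ∀ M : Submodule ℂ H₁, IsClosed (M : Set H₁) → M ≠ ⊥ →
    IsMinimumAttaining (T.comp M.subtypeL)

/-- `V` is a partial isometry if it is isometric on the orthogonal complement of its null space. -/
def IsPartialIsometry (V : H₁ →L[ℂ] H₂) : Prop :=
  ∀ x ∈ (LinearMap.ker (V : H₁ →ₗ[ℂ] H₂))ᗮ, ‖V x‖ = ‖x‖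

end MinimumAttaining

section MinimumAttaining

variable {H₁ H₂ : Type*}
  [NormedAddCommGroup H₁] [InnerProductSpace ℂ H₁]
  [NormedAddCommGroup H₂] [InnerProductSpace ℂ H₂]

/-! With `P` the orthogonal projection onto `N(V)`, Pythagoras gives `‖V x‖² = ‖x‖² - ‖P x‖²`, so
`V` attains its minimum on the unit sphere of `M` exactly where `P` attains its maximum. If `N(V)`
is finite dimensional, `P` restricted to `M` has finite rank and attains its norm. If `R(V)` is
finite dimensional, compactness or a kernel vector suffices.

Conversely, if `N(V)` and `N(V)ᗮ` are both infinite dimensional, take orthonormal sequences `e n`,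
`f n` in them. On the closed span of the vectors `(n + 1) e n + f n` the infimum is 0, yet `V` is
injective there. -/

theorem isMinimumAttaining_of_forall_le {T : H₁ →L[ℂ] H₂} {x₀ : H₁} (hx₀ : ‖x₀‖ = 1)
    (h : ∀ x : H₁, ‖x‖ = 1 → ‖T x₀‖ ≤ ‖T x‖) : IsMinimumAttaining T := by
  refine ⟨x₀, hx₀, IsLeast.csInf_eq ⟨⟨x₀, hx₀, rfl⟩, ?_⟩⟩
  rintro r ⟨x, hx, rfl⟩
  exact h x hx

theorem minimumModulus_le (T : H₁ →L[ℂ] H₂) {x : H₁} (hx : ‖x‖ = 1) :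
    minimumModulus T ≤ ‖T x‖ := by
  refine csInf_le ⟨0, ?_⟩ ⟨x, hx, rfl⟩
  rintro r ⟨y, -, rfl⟩
  exact norm_nonneg _

/-- A finite rank operator on a nontrivial Hilbert space attains its norm. -/
theorem exists_norm_eq_one_forall_norm_apply_le [CompleteSpace H₁] [Nontrivial H₁]
    [FiniteDimensional ℂ H₂] (T : H₁ →L[ℂ] H₂) :
    ∃ x₀ : H₁, ‖x₀‖ = 1 ∧ ∀ x : H₁, ‖x‖ = 1 → ‖T x‖ ≤ ‖T x₀‖ := by
  obtain ⟨u, hu⟩ := exists_norm_eq H₁ zero_le_one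
  set K : Submodule ℂ H₁ := LinearMap.ker (T : H₁ →ₗ[ℂ] H₂) with hK
  have hKc : IsClosed (K : Set H₁) := T.isClosed_ker
  have : CompleteSpace K := hKc.completeSpace_coe
  have hT : ∀ x : H₁, T x = T (Kᗮ.starProjection x) := by
    intro x
    have h1 : T (x - Kᗮ.starProjection x) = 0 := by
      have h2 : x - Kᗮ.starProjection x ∈ Kᗮᗮ := Submodule.sub_starProjection_mem_orthogonal x
      rw [Submodule.orthogonal_orthogonal] at h2
      exact h2
    rw [map_sub] at h1
    exact sub_eq_zero.1 h1
  have : FiniteDimensional ℂ Kᗮ := by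
    refine FiniteDimensional.of_injective ((T : H₁ →ₗ[ℂ] H₂).comp Kᗮ.subtype) ?_
    rw [← LinearMap.ker_eq_bot, LinearMap.ker_eq_bot']
    intro x hx
    have h0 : (x : H₁) ∈ K ⊓ Kᗮ := ⟨hx, x.2⟩
    rw [Submodule.inf_orthogonal_eq_bot] at h0
    exact Subtype.ext h0
  by_cases hbot : Kᗮ = ⊥
  · refine ⟨u, hu, fun x _ => ?_⟩
    have h0 : ∀ y : H₁, T y = 0 := by
      intro y
      have hy : Kᗮ.starProjection y ∈ Kᗮ := Submodule.starProjection_apply_mem _ _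
      have h1 : Kᗮ.starProjection y = 0 := (Submodule.mem_bot ℂ).1 (hbot.le hy)
      rw [hT, h1, map_zero]
    rw [h0, h0]
  · have : Nontrivial Kᗮ := Submodule.nontrivial_iff_ne_bot.2 hbot
    have : ProperSpace Kᗮ := FiniteDimensional.proper ℂ Kᗮ
    obtain ⟨v, hv⟩ := exists_norm_eq Kᗮ zero_le_one
    obtain ⟨z, hz, hmax⟩ := (isCompact_sphere (0 : Kᗮ) 1).exists_isMaxOn
      ⟨v, by simpa using hv⟩
      (show ContinuousOn (fun y : Kᗮ => ‖T y‖) _ by fun_prop)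
    refine ⟨z, by simpa using hz, fun x hx => ?_⟩
    rw [hT x]
    set y : Kᗮ := Kᗮ.orthogonalProjectionOnto x with hy
    have hyx : ‖y‖ ≤ 1 := hx ▸ Submodule.norm_orthogonalProjectionOnto_apply_le Kᗮ x
    change ‖T (y : H₁)‖ ≤ _
    by_cases hy0 : y = 0
    · simp [hy0]
    -- Projecting a unit vector to `Kᗮ` keeps its value under `T` but may shorten it; renormalizing
    -- can only increase `‖T y‖`.
    · have hm := hmax (show ((‖y‖⁻¹ : ℂ) • y) ∈ Metric.sphere (0 : Kᗮ) 1 by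
        simp [norm_smul, hy0])
      have hpos : 0 < ‖y‖ := norm_pos_iff.2 hy0
      have hm' : ‖y‖⁻¹ * ‖T (y : H₁)‖ ≤ ‖T (z : H₁)‖ := by
        simpa [norm_smul] using hm
      rw [inv_mul_le_iff₀ hpos] at hm'
      exact hm'.trans (mul_le_of_le_one_left (norm_nonneg _) hyx)

/-- An operator of finite rank on a nontrivial inner product space is minimum attaining. -/
theorem isMinimumAttaining_of_finiteDimensional_range [Nontrivial H₁] (T : H₁ →L[ℂ] H₂)
    [FiniteDimensional ℂ (LinearMap.range (T : H₁ →ₗ[ℂ] H₂))] : IsMinimumAttaining T := by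
  -- Injectivity forces a finite dimensional domain with compact sphere; otherwise a unit kernel
  -- vector attains 0.
  by_cases hker : LinearMap.ker (T : H₁ →ₗ[ℂ] H₂) = ⊥
  · have : FiniteDimensional ℂ H₁ :=
      FiniteDimensional.of_injective (T : H₁ →ₗ[ℂ] H₂).rangeRestrict
        (by rw [← LinearMap.ker_eq_bot, LinearMap.ker_rangeRestrict, hker])
    have : ProperSpace H₁ := FiniteDimensional.proper ℂ H₁
    obtain ⟨v, hv⟩ := exists_norm_eq H₁ zero_le_one
    obtain ⟨z, hz, hmin⟩ := (isCompact_sphere (0 : H₁) 1).exists_isMinOn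
      ⟨v, by simpa using hv⟩ (show ContinuousOn (fun y : H₁ => ‖T y‖) _ by fun_prop)
    exact isMinimumAttaining_of_forall_le (by simpa using hz)
      fun x hx => hmin (show x ∈ Metric.sphere (0 : H₁) 1 by simpa using hx)
  · obtain ⟨x, hx, hx0⟩ := Submodule.exists_mem_ne_zero_of_ne_bot hker
    have hTx : T x = 0 := hx
    refine isMinimumAttaining_of_forall_le (x₀ := (‖x‖⁻¹ : ℂ) • x)
      (by simp [norm_smul, hx0]) fun y _ => ?_
    simp [hTx]

theorem mem_orthogonal_span {s : Set H₁} {x : H₁} (h : ∀ u ∈ s, inner ℂ u x = 0) :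
    x ∈ (Submodule.span ℂ s)ᗮ := by
  have hle : Submodule.span ℂ s ≤ (Submodule.span ℂ {x})ᗮ := Submodule.span_le.2 fun u hu =>
    Submodule.mem_orthogonal_singleton_iff_inner_left.2 (h u hu)
  exact fun u hu => Submodule.mem_orthogonal_singleton_iff_inner_left.1 (hle hu)

/-- Gram–Schmidt applied to countably many vectors of a Hamel basis. -/
theorem exists_orthonormal_nat_of_not_finiteDimensional (h : ¬ FiniteDimensional ℂ H₁) :
    ∃ e : ℕ → H₁, Orthonormal ℂ e := by
  have b := Module.Basis.ofVectorSpace ℂ H₁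
  have : Infinite (Module.Basis.ofVectorSpaceIndex ℂ H₁) := by
    by_contra hfin
    rw [not_infinite_iff_finite] at hfin
    exact h (Module.Finite.of_basis b)
  exact ⟨_, InnerProductSpace.gramSchmidtNormed_orthonormal
    (b.linearIndependent.comp _ (Infinite.natEmbedding _).injective)⟩

theorem IsPartialIsometry.norm_apply_eq [CompleteSpace H₁] {V : H₁ →L[ℂ] H₂}
    (hV : IsPartialIsometry V) {u w : H₁} (hu : V u = 0)
    (hw : w ∈ (LinearMap.ker (V : H₁ →ₗ[ℂ] H₂))ᗮ) : ‖V (u + w)‖ = ‖w‖ := by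
  rw [map_add, hu, zero_add, hV w hw]

/-- A partial isometry with finite dimensional kernel is absolutely minimum attaining. -/
theorem IsPartialIsometry.isAbsolutelyMinimumAttaining_of_ker [CompleteSpace H₁]
    {V : H₁ →L[ℂ] H₂} (hV : IsPartialIsometry V)
    [FiniteDimensional ℂ (LinearMap.ker (V : H₁ →ₗ[ℂ] H₂))] :
    IsAbsolutelyMinimumAttaining V := by
  intro M hM hne
  have : CompleteSpace M := hM.completeSpace_coe
  have : Nontrivial M := Submodule.nontrivial_iff_ne_bot.2 hne
  set K := LinearMap.ker (V : H₁ →ₗ[ℂ] H₂) with hK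
  obtain ⟨x₀, hx₀, hmax⟩ :=
    exists_norm_eq_one_forall_norm_apply_le (K.orthogonalProjectionOnto.comp M.subtypeL)
  have key : ∀ x : M, ‖V x‖ ^ 2 = ‖x‖ ^ 2 - ‖K.orthogonalProjectionOnto (x : H₁)‖ ^ 2 := by
    intro x
    have h1 : ‖V x‖ = ‖Kᗮ.orthogonalProjectionOnto (x : H₁)‖ := by
      have h3 := hV.norm_apply_eq (u := K.starProjection (x : H₁))
        (w := Kᗮ.starProjection (x : H₁)) (Submodule.starProjection_apply_mem K _)
        (Submodule.starProjection_apply_mem Kᗮ _)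
      rw [Submodule.starProjection_add_starProjection_orthogonal] at h3
      exact h3
    have h2 := Submodule.norm_sq_eq_add_norm_sq_projection (x : H₁) K
    rw [h1, show ‖x‖ ^ 2 = _ from h2, add_sub_cancel_left]
  refine isMinimumAttaining_of_forall_le hx₀ fun x hx => ?_
  have h := hmax x hx
  change ‖K.orthogonalProjectionOnto (x : H₁)‖ ≤ ‖K.orthogonalProjectionOnto (x₀ : H₁)‖ at h
  change ‖V (x₀ : H₁)‖ ≤ ‖V (x : H₁)‖
  have h2 := pow_le_pow_left₀ (norm_nonneg _) h 2
  refine le_of_sq_le_sq ?_ (norm_nonneg _)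
  rw [key, key, hx, hx₀]
  linarith

/-- An absolutely minimum attaining partial isometry has finite dimensional kernel or finite
dimensional initial space. -/
theorem IsPartialIsometry.finiteDimensional_ker_or_orthogonal [CompleteSpace H₁]
    {V : H₁ →L[ℂ] H₂} (hV : IsPartialIsometry V) (h : IsAbsolutelyMinimumAttaining V) :
    FiniteDimensional ℂ (LinearMap.ker (V : H₁ →ₗ[ℂ] H₂)) ∨
      FiniteDimensional ℂ (LinearMap.ker (V : H₁ →ₗ[ℂ] H₂))ᗮ := by
  set K := LinearMap.ker (V : H₁ →ₗ[ℂ] H₂)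
  by_contra! hcon
  obtain ⟨hK, hN⟩ := hcon
  obtain ⟨e, he⟩ := exists_orthonormal_nat_of_not_finiteDimensional hK
  obtain ⟨f, hf⟩ := exists_orthonormal_nat_of_not_finiteDimensional hN
  have hee : ∀ i j, inner ℂ (e i : H₁) (e j : H₁) = if i = j then (1 : ℂ) else 0 :=
    fun i j => orthonormal_iff_ite.1 he i j
  have hff : ∀ i j, inner ℂ (f i : H₁) (f j : H₁) = if i = j then (1 : ℂ) else 0 :=
    fun i j => orthonormal_iff_ite.1 hf i j
  have hef : ∀ i j, inner ℂ (e i : H₁) (f j : H₁) = 0 := fun i j => (f j).2 _ (e i).2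
  have hfe : ∀ i j, inner ℂ (f i : H₁) (e j : H₁) = 0 := fun i j => inner_eq_zero_symm.1 (hef j i)
  -- `M` is the closed span of the vectors `(n + 1) e n + f n`
  let S : Submodule ℂ H₁ :=
    Submodule.span ℂ (Set.range (fun n => (e n : H₁)) ∪ Set.range (fun n => (f n : H₁)))
  let W : Submodule ℂ H₁ :=
    Submodule.span ℂ (Set.range fun n : ℕ => (e n : H₁) - ((n : ℂ) + 1) • (f n : H₁))
  -- `e n - (n + 1) f n` spans the orthogonal complement of `g n` in the plane of `e n` and `f n`,
  -- so membership in `M` becomes a set of orthogonality relations.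
  let M : Submodule ℂ H₁ := Wᗮ ⊓ Sᗮᗮ
  let g : ℕ → H₁ := fun n => ((n : ℂ) + 1) • (e n : H₁) + (f n : H₁)
  have heS : ∀ n, (e n : H₁) ∈ S := fun n => Submodule.subset_span (Or.inl ⟨n, rfl⟩)
  have hfS : ∀ n, (f n : H₁) ∈ S := fun n => Submodule.subset_span (Or.inr ⟨n, rfl⟩)
  have hgM : ∀ n, g n ∈ M := by
    intro n
    refine ⟨?_, Submodule.le_orthogonal_orthogonal S
      (S.add_mem (S.smul_mem _ (heS n)) (hfS n))⟩
    refine mem_orthogonal_span ?_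
    rintro _ ⟨k, rfl⟩
    simp only [g, inner_sub_left, inner_add_right, inner_smul_left, inner_smul_right, hee, hff,
      hef, hfe]
    by_cases hkn : k = n
    · subst hkn; simp
    · simp [hkn]
  have hgn : ∀ n : ℕ, (n : ℝ) + 1 ≤ ‖g n‖ := by
    intro n
    have h1 : inner ℂ (e n : H₁) (g n) = (n : ℂ) + 1 := by
      rw [inner_add_right, inner_smul_right, hee, hef, if_pos rfl, mul_one, add_zero]
    have h2 := norm_inner_le_norm (𝕜 := ℂ) (e n : H₁) (g n)
    have h3 : ‖(e n : H₁)‖ = 1 := he.1 n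
    have h4 : ‖(n : ℂ) + 1‖ = (n : ℝ) + 1 := by
      have := Complex.norm_natCast (n + 1)
      push_cast at this
      exact this
    rwa [h1, h3, one_mul, h4] at h2
  have hVg : ∀ n, ‖V (g n)‖ = 1 := by
    intro n
    rw [hV.norm_apply_eq (K.smul_mem _ (e n).2) (f n).2]
    exact hf.1 n
  have hg0 : ∀ n, g n ≠ 0 := fun n h0 => by simpa [h0] using hVg n
  have hMc : IsClosed (M : Set H₁) :=
    W.isClosed_orthogonal.inter Sᗮ.isClosed_orthogonal
  have hMne : M ≠ ⊥ := fun hb => hg0 0 ((Submodule.mem_bot ℂ).1 (hb.le (hgM 0)))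
  obtain ⟨x, hx1, hx⟩ := h M hMc hMne
  change minimumModulus (V.comp M.subtypeL) = ‖V (x : H₁)‖ at hx
  -- The normalized `g n` bound the minimum modulus by `1 / (n + 1)`.
  have hVx : V (x : H₁) = 0 := by
    rw [← norm_le_zero_iff]
    refine le_of_forall_pos_le_add fun ε hε => ?_
    obtain ⟨n, hn⟩ := exists_nat_one_div_lt hε
    have hle := minimumModulus_le (V.comp M.subtypeL) (x := (‖g n‖⁻¹ : ℂ) • ⟨g n, hgM n⟩)
      (by simp [norm_smul, hg0 n])
    have hle' : minimumModulus (V.comp M.subtypeL) ≤ ‖g n‖⁻¹ := by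
      simpa [norm_smul, hVg n] using hle
    have hinv : ‖g n‖⁻¹ ≤ 1 / ((n : ℝ) + 1) := by
      rw [one_div]
      exact inv_anti₀ (by positivity) (hgn n)
    linarith
  -- Now `x ∈ K` is orthogonal to every `f n`, hence by `Wᗮ` to every `e n`, so it lies in `Sᗮ ⊓
  -- Sᗮᗮ` and vanishes.
  have hxf : ∀ n, inner ℂ (f n : H₁) (x : H₁) = 0 := fun n =>
    inner_eq_zero_symm.1 ((f n).2 _ hVx)
  have hxe : ∀ n, inner ℂ (e n : H₁) (x : H₁) = 0 := fun n => by
    have h1 := x.2.1 _ (Submodule.subset_span ⟨n, rfl⟩)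
    simpa [inner_sub_left, inner_smul_left, hxf n] using h1
  have hxS : (x : H₁) ∈ Sᗮ := by
    refine mem_orthogonal_span ?_
    rintro _ (⟨k, rfl⟩ | ⟨k, rfl⟩)
    exacts [hxe k, hxf k]
  have hx0 : (x : H₁) = 0 := inner_self_eq_zero.1 (x.2.2 _ hxS)
  have : ‖(x : H₁)‖ = 1 := hx1
  simp [hx0] at this

/-- Dropping the kernel component of a vector does not change its image, so `Kᗮ` already maps onto
the range. -/
theorem finiteDimensional_range_of_orthogonal_ker [CompleteSpace H₁] (T : H₁ →L[ℂ] H₂)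
    [FiniteDimensional ℂ (LinearMap.ker (T : H₁ →ₗ[ℂ] H₂))ᗮ] :
    FiniteDimensional ℂ (LinearMap.range (T : H₁ →ₗ[ℂ] H₂)) := by
  set K := LinearMap.ker (T : H₁ →ₗ[ℂ] H₂) with hK
  have : CompleteSpace K := T.isClosed_ker.completeSpace_coe
  have hle : LinearMap.range (T : H₁ →ₗ[ℂ] H₂) ≤ Kᗮ.map (T : H₁ →ₗ[ℂ] H₂) := by
    rintro _ ⟨x, rfl⟩
    refine ⟨Kᗮ.starProjection x, Submodule.starProjection_apply_mem _ _, ?_⟩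
    have h1 : T (K.starProjection x) = 0 := Submodule.starProjection_apply_mem K x
    have h2 := congrArg T (K.starProjection_add_starProjection_orthogonal x)
    rwa [map_add, h1, zero_add] at h2
  exact Submodule.finiteDimensional_of_le hle

/-- Finite rank operators are absolutely minimum attaining. -/
theorem isAbsolutelyMinimumAttaining_of_finiteDimensional_range (T : H₁ →L[ℂ] H₂)
    [FiniteDimensional ℂ (LinearMap.range (T : H₁ →ₗ[ℂ] H₂))] :
    IsAbsolutelyMinimumAttaining T := by
  intro M _ hne
  have : Nontrivial M := Submodule.nontrivial_iff_ne_bot.2 hne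
  have : FiniteDimensional ℂ (LinearMap.range ((T.comp M.subtypeL : M →L[ℂ] H₂) : M →ₗ[ℂ] H₂)) :=
    Submodule.finiteDimensional_of_le (S₂ := LinearMap.range (T : H₁ →ₗ[ℂ] H₂)) (by
      rintro _ ⟨x, rfl⟩
      exact ⟨x, rfl⟩)
  exact isMinimumAttaining_of_finiteDimensional_range _

end MinimumAttaining

theorem mainTheorem11 {H : Type*} [NormedAddCommGroup H] [InnerProductSpace ℂ H]
    [CompleteSpace H] (V : H →L[ℂ] H) (hV : IsPartialIsometry V) :
    IsAbsolutelyMinimumAttaining V ↔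
      (FiniteDimensional ℂ (LinearMap.ker (V : H →ₗ[ℂ] H)) ∨
        FiniteDimensional ℂ (LinearMap.range (V : H →ₗ[ℂ] H))) := by
  constructor
  · intro h
    rcases hV.finiteDimensional_ker_or_orthogonal h with hK | hN
    · exact Or.inl hK
    · exact Or.inr (finiteDimensional_range_of_orthogonal_ker V)
  · rintro (h | h)
    · exact hV.isAbsolutelyMinimumAttaining_of_ker
    · exact isAbsolutelyMinimumAttaining_of_finiteDimensional_range V
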